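/- Let $R,\Gamma,\theta>0$ and put $\tilde\Theta=(2^R-1)/\Gamma$. Let $W_0$ be the principal branch of the Lambert function: for $x\ge -1/\mathrm e$, $W_0(x)$ is the unique $w\ge -1$ with $w\mathrm e^{w}=x$. Persistent repetition-redundancy (RR) HARQ in block Rayleigh fading with signal-to-noise ratio $\Gamma$ is the following scheme. The power gains $g_1,g_2,\dots$ of the successive timeslots are i.i.d. exponential random variables with mean $1$. A packet of rate $R$ is retransmitted, one transmission per timeslot and without limit on the number of transmissions, until $\log_2(1+\Gamma\sum g_i)\ge R$, where the sum is over the timeslots used so far for this packet; then the packet is decoded, and the next timeslot starts a new packet. Let $N_k$ be the number of packets decoded in the first $k$ timeslots. Then the limit that defines the effective capacity exists, and $$C_{\mathrm{eff}}^{\mathrm{RR}}:=-\lim_{k\to\infty}\frac{1}{\theta k}\ln\mathbb E\{\mathrm e^{-\theta R N_k}\}=R-\frac1\theta\Bigl(W_0\bigl(\tilde\Theta \mathrm e^{\tilde\Theta+\theta R}\bigr)-\tilde\Theta\Bigr).$$ Moreover, let $Q_m=\mathbb P\{\log_2(1+\Gamma\sum_{i=1}^m g_i)<R\}$ for $m\ge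 0$ and $P_m=Q_{m-1}-Q_m$ for $m\ge1$. The corresponding spectral radius is $$\lambda_+=\frac{\tilde\Theta}{W_0\bigl(\tilde\Theta \mathrm e^{\tilde\Theta+\theta R}\bigr)},\qquad\text{and}\qquad C_{\mathrm{eff}}^{\mathrm{RR}}=-\frac{\ln\lambda_+}{\theta}.$$ Here "spectral radius" means both of the following. First, $\lambda_+>0$ is a root of the characteristic equation $1=\sum_{m=1}^\infty P_m\mathrm e^{-\theta R}\lambda^{-m}$ of persistent HARQ, and every root $\lambda\in\mathbb C\setminus\{0\}$ satisfies $|\lambda|\le\lambda_+$. Secondly, $\lambda_+$ is the limit, as $M\to\infty$, of the spectral radii of the $M\times M$ companion matrices of RR-HARQ truncated to at most $M$ transmissions per packet; such a matrix has first row $a_1,\dots,a_M$, ones on the subdiagonal and zeros elsewhere, where $a_m=P_m\mathrm e^{-\theta R}$ for $m<M$ and $a_M=P_M\mathrm e^{-\theta R}+Q_M$. -/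

import Mathlib

open MeasureTheory ProbabilityTheory Filter Topology

noncomputable section

/-! ### The principal branch of the Lambert function -/

/-- The principal branch `W₀` of the Lambert function: for `x ≥ -1/e`, the unique `w ≥ -1` with
`w * exp w = x`. -/
def lambertW0 (x : ℝ) : ℝ :=
  Function.invFunOn (fun w : ℝ => w * Real.exp w) (Set.Ici (-1)) x

theorem strictMonoOn_mul_exp :
    StrictMonoOn (fun w : ℝ => w * Real.exp w) (Set.Ici (-1)) := by
  apply strictMonoOn_of_deriv_pos (convex_Ici _)
  · exact (continuous_id.mul Real.continuous_exp).continuousOn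
  · intro w hw
    rw [interior_Ici, Set.mem_Ioi] at hw
    have h : HasDerivAt (fun w : ℝ => w * Real.exp w)
        (1 * Real.exp w + w * Real.exp w) w :=
      (hasDerivAt_id w).mul (Real.hasDerivAt_exp w)
    rw [h.deriv]
    have : 0 < (1 + w) * Real.exp w := mul_pos (by linarith) (Real.exp_pos w)
    linarith

/-- `lambertW0 x` is characterised, for `x ≥ -1/e`, by the defining equation of `W₀`. -/
theorem lambertW0_eq_iff {x w : ℝ} (hx : -Real.exp (-1) ≤ x) :
    lambertW0 x = w ↔ -1 ≤ w ∧ w * Real.exp w = x := by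
  have hex : ∃ a ∈ Set.Ici (-1 : ℝ), a * Real.exp a = x := by
    have hc : ContinuousOn (fun w : ℝ => w * Real.exp w) (Set.Icc (-1) (max x 0)) :=
      (continuous_id.mul Real.continuous_exp).continuousOn
    have h0 : (-1 : ℝ) ≤ max x 0 := le_trans (by norm_num) (le_max_right _ _)
    have hx1 : x ≤ max x 0 * Real.exp (max x 0) := by
      have h1 : 1 ≤ Real.exp (max x 0) := Real.one_le_exp (le_max_right _ _)
      have h2 : 0 ≤ max x 0 := le_max_right _ _
      nlinarith [le_max_left x 0]
    obtain ⟨a, ha, hax⟩ := intermediate_value_Icc h0 hc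
      (show x ∈ Set.Icc _ _ from ⟨by simpa using hx, hx1⟩)
    exact ⟨a, ha.1, hax⟩
  have hmem : lambertW0 x ∈ Set.Ici (-1 : ℝ) := Function.invFunOn_mem hex
  have heq : lambertW0 x * Real.exp (lambertW0 x) = x := Function.invFunOn_eq hex
  constructor
  · rintro rfl
    exact ⟨hmem, heq⟩
  · rintro ⟨hw, hwx⟩
    exact strictMonoOn_mul_exp.injOn hmem hw (heq.trans hwx.symm)

/-! ### The effective capacity -/

/-- `C` is the effective capacity, with QoS exponent `θ`, of the accumulated service process `ζ`:
`C = - lim_{k → ∞} (1 / (θ k)) ln E[exp (-θ ζ_k)]`, where the expectations and the limit exist. -/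
def HasEffectiveCapacity {Ω : Type*} [MeasurableSpace Ω] (μ : Measure Ω) (θ : ℝ)
    (ζ : ℕ → Ω → ℝ) (C : ℝ) : Prop :=
  (∀ k, Integrable (fun ω => Real.exp (-θ * ζ k ω)) μ) ∧
  Tendsto (fun k : ℕ => -(1 / (θ * k)) * Real.log (∫ ω, Real.exp (-θ * ζ k ω) ∂μ))
    atTop (𝓝 C)

/-! ### Persistent repetition-redundancy HARQ in block Rayleigh fading -/

/-- Block Rayleigh fading with unit mean power: the power gains of the successive transmissions
are independent and exponentially distributed with mean `1`, i.e. with pdf `exp (-z)` and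
Laplace transform `1 / (1 + s)`. -/
structure IsBlockRayleighFading {Ω : Type*} [MeasurableSpace Ω] (μ : Measure Ω)
    (g : ℕ → Ω → ℝ) : Prop where
  indep : iIndepFun g μ
  law : ∀ i, HasLaw (g i) (expMeasure 1) μ

/-- The mutual information after maximum ratio combining of transmissions with total power
gain `x`, at signal-to-noise ratio `Γ`. -/
def combinedInformation (Γ x : ℝ) : ℝ := Real.logb 2 (1 + Γ * x)

open Classical in
/-- State of persistent repetition-redundancy HARQ after `k` timeslots, for the sequence of power
gains `g` (where `g k` is the gain of timeslot `k + 1`): the number of packets decoded so far,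
and the total power gain collected for the packet in progress. A packet of rate `R` is decoded
as soon as its combined mutual information is at least `R`; then the stored information is
cleared, and the next timeslot starts a new packet. -/
def rrState (R Γ : ℝ) (g : ℕ → ℝ) : ℕ → ℕ × ℝ
  | 0 => (0, 0)
  | k + 1 =>
    if R ≤ combinedInformation Γ ((rrState R Γ g k).2 + g k) then
      ((rrState R Γ g k).1 + 1, 0)
    else
      ((rrState R Γ g k).1, (rrState R Γ g k).2 + g k)

/-- `N_k`: the number of packets decoded in the first `k` timeslots. -/
def rrPackets (R Γ : ℝ) (g : ℕ → ℝ) (k : ℕ) : ℕ := (rrState R Γ g k).1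

/-- `Q_m`: the probability that a packet is not decoded up to and including its `m`-th
transmission. -/
def rrFailProb {Ω : Type*} [MeasurableSpace Ω] (μ : Measure Ω) (g : ℕ → Ω → ℝ) (R Γ : ℝ)
    (m : ℕ) : ℝ :=
  μ.real {ω | combinedInformation Γ (∑ i ∈ Finset.range m, g i ω) < R}

/-- `P_m = Q_{m-1} - Q_m`, for `m ≥ 1`: the probability that a packet is decoded at its `m`-th
transmission. -/
def rrSuccessProb {Ω : Type*} [MeasurableSpace Ω] (μ : Measure Ω) (g : ℕ → Ω → ℝ) (R Γ : ℝ)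
    (m : ℕ) : ℝ :=
  rrFailProb μ g R Γ (m - 1) - rrFailProb μ g R Γ m

/-! ### The spectral radius -/

/-- The coefficients `a_m`, `1 ≤ m ≤ M`, of HARQ truncated to at most `M` transmissions per packet,
with success probabilities `p m` and failure probability `q`:
`a_m = p m * exp (-θ R)` for `m < M`, and `a_M = p M * exp (-θ R) + q`. -/
def harqCoeff (p : ℕ → ℝ) (q θ R : ℝ) (M m : ℕ) : ℝ :=
  if m = M then p M * Real.exp (-θ * R) + q else p m * Real.exp (-θ * R)

/-- The `M × M` companion matrix of truncated HARQ: the first row is `a_1, …, a_M`, the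
subdiagonal consists of ones, and all other entries are zero. -/
def harqMatrix (p : ℕ → ℝ) (q θ R : ℝ) (M : ℕ) : Matrix (Fin M) (Fin M) ℂ :=
  Matrix.of fun i j =>
    if i.val = 0 then ((harqCoeff p q θ R M (j.val + 1) : ℝ) : ℂ)
    else if i.val = j.val + 1 then 1 else 0

/-- `z` is a root of the characteristic equation `1 = ∑_{m ≥ 1} p m * exp (-θ R) * z ^ (-m)` of
persistent HARQ with success probabilities `p m`. -/
def IsHarqCharRoot (p : ℕ → ℝ) (θ R : ℝ) (z : ℂ) : Prop :=
  z ≠ 0 ∧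
  HasSum (fun m : ℕ => ((p (m + 1) * Real.exp (-θ * R) : ℝ) : ℂ) * z⁻¹ ^ (m + 1)) 1

/-- `lam` is the spectral radius of persistent HARQ with success probabilities `p m` and failure
probabilities `q m`: it is a positive root of the characteristic equation of largest modulus
among all complex roots, and it is the limit, as the transmission limit `M` tends to infinity,
of the spectral radii of the companion matrices of truncated HARQ. -/
structure IsPersistentSpectralRadius (p q : ℕ → ℝ) (θ R lam : ℝ) : Prop where
  pos : 0 < lam
  isRoot : IsHarqCharRoot p θ R (lam : ℂ)
  largest : ∀ z : ℂ, IsHarqCharRoot p θ R z → ‖z‖ ≤ lam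
  tendsto : Tendsto (fun M : ℕ => spectralRadius ℂ (harqMatrix p (q M) θ R M))
    atTop (𝓝 (ENNReal.ofReal lam))

end

/-! Decoding happens exactly when the collected gain reaches `T`, and exponential gains are the
interarrival times of a unit rate Poisson process. So a packet needs one plus a Poisson(`T`) number
of transmissions (`rrSuccessProb_succ`), and with `x = exp (-θ R)` the characteristic equation sums
to `x * exp (-T) * λ⁻¹ * exp (T / λ) = 1`. Substituting `w = T / λ` gives the Lambert equation.

For the capacity, the packet count `N` and collected gain `S` form a Markov chain with an explicit
positive eigenfunction `h s = exp (s (1 - 1/λ))` (`lintegral_rrStep`). Hence `E[x ^ N_k * h S_k] = λ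
^ k` exactly. Since `h` lies between two positive constants on `[0, T)`, `E[x ^ N_k]` equals `λ ^ k`
up to a bounded factor, which disappears after taking logarithms and dividing by `k`.

For the truncations, nonnegative coefficients make the largest modulus of an eigenvalue a matter of
one increasing function of `1/s`; these functions converge to the limiting characteristic function,
so their roots are squeezed to `λ` (`isPersistentSpectralRadius_of_poisson`). -/

/-! ### The Lambert function and the root `λ` -/

theorem lambertW0_mul_exp_spec {T a : ℝ} (hT : 0 < T) (ha : 0 < a) :
    T < lambertW0 (T * Real.exp (T + a)) ∧
      lambertW0 (T * Real.exp (T + a)) * Real.exp (lambertW0 (T * Real.exp (T + a))) =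
        T * Real.exp (T + a) := by
  have hx : -Real.exp (-1) ≤ T * Real.exp (T + a) :=
    le_trans (neg_nonpos.2 (Real.exp_pos _).le) (by positivity)
  obtain ⟨h1, h2⟩ := (lambertW0_eq_iff hx).1 rfl
  refine ⟨?_, h2⟩
  have : T * Real.exp T < T * Real.exp (T + a) := by
    gcongr; linarith
  rw [← h2] at this
  exact (strictMonoOn_mul_exp.lt_iff_lt (Set.mem_Ici.2 (by linarith)) h1).1 this

/-- With `w = T / lam`, the last equation is `w * exp w = T * exp (T + a)` rearranged; `lam < 1`
amounts to `T < w`, where `0 < a` enters. -/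
theorem lambert_radius_spec {T a : ℝ} (hT : 0 < T) (ha : 0 < a) :
    let lam := T / lambertW0 (T * Real.exp (T + a))
    0 < lam ∧ lam < 1 ∧ Real.exp (-a) * Real.exp (-T) * Real.exp (T * lam⁻¹) = lam := by
  intro lam
  obtain ⟨h1, h2⟩ := lambertW0_mul_exp_spec hT ha
  have hw : 0 < lambertW0 (T * Real.exp (T + a)) := hT.trans h1
  refine ⟨div_pos hT hw, (div_lt_one hw).2 h1, ?_⟩
  have e : T * lam⁻¹ = lambertW0 (T * Real.exp (T + a)) := by
    simp only [lam]; field_simp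
  rw [e]
  simp only [lam]
  rw [eq_div_iff hw.ne', mul_assoc, mul_comm (Real.exp (lambertW0 _)), h2, ← Real.exp_add,
    mul_left_comm, ← Real.exp_add]
  ring_nf; simp

theorem log_lambert_radius {T a : ℝ} (hT : 0 < T) (ha : 0 < a) :
    Real.log (T / lambertW0 (T * Real.exp (T + a))) =
      lambertW0 (T * Real.exp (T + a)) - T - a := by
  obtain ⟨h1, h2⟩ := lambertW0_mul_exp_spec hT ha
  have hw : 0 < lambertW0 (T * Real.exp (T + a)) := hT.trans h1
  have := congrArg Real.log h2
  rw [Real.log_mul hw.ne' (Real.exp_pos _).ne', Real.log_mul hT.ne' (Real.exp_pos _).ne',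
    Real.log_exp, Real.log_exp] at this
  rw [Real.log_div hT.ne' hw.ne']
  linarith

/-! ### The characteristic function of Poisson success probabilities -/

theorem hasSum_poisson_char (T x : ℝ) (z : ℂ) :
    HasSum (fun m : ℕ => ((Real.exp (-T) * (T ^ m / m.factorial) * x : ℝ) : ℂ) * z ^ (m + 1))
      ((x * Real.exp (-T) : ℝ) * z * Complex.exp (T * z)) := by
  have h := (NormedSpace.expSeries_div_hasSum_exp (𝔸 := ℂ) (T * z)).mul_left
    (((x * Real.exp (-T) : ℝ) : ℂ) * z)
  rw [← Complex.exp_eq_exp_ℂ] at h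
  convert! h using 2 with m
  push_cast
  rw [mul_pow]
  ring

theorem hasSum_poisson_char_real (T x z : ℝ) :
    HasSum (fun m : ℕ => (Real.exp (-T) * (T ^ m / m.factorial) * x) * z ^ (m + 1))
      (x * Real.exp (-T) * z * Real.exp (T * z)) := by
  have h := hasSum_poisson_char T x z
  exact_mod_cast h

theorem poisson_char_strictMono {T c s t : ℝ} (hT : 0 < T) (hc : 0 < c) (hs : 0 < s)
    (hst : s < t) : c * s * Real.exp (T * s) < c * t * Real.exp (T * t) := by
  gcongr

/-! ### Spectra of the companion matrices -/

/-- The subdiagonal rows force an eigenvector to be `v j = z⁻¹ ^ j * v 0`; the first row is then the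
only remaining condition. -/
theorem harqMatrix_mem_spectrum_iff (p : ℕ → ℝ) (q θ R : ℝ) {M : ℕ} (hM : 0 < M) {z : ℂ}
    (hz : z ≠ 0) :
    z ∈ spectrum ℂ (harqMatrix p q θ R M) ↔
      ∑ j ∈ Finset.range M, ((harqCoeff p q θ R M (j + 1) : ℝ) : ℂ) * z⁻¹ ^ (j + 1) = 1 := by
  obtain ⟨n, rfl⟩ : ∃ n, M = n + 1 := ⟨M - 1, by omega⟩
  rw [← Matrix.spectrum_toLin', ← Module.End.hasEigenvalue_iff_mem_spectrum]
  have row0 (v : Fin (n + 1) → ℂ) : (harqMatrix p q θ R (n + 1)).mulVec v 0 =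
      ∑ j : Fin (n + 1), ((harqCoeff p q θ R (n + 1) (j + 1) : ℝ) : ℂ) * v j := by
    simp [Matrix.mulVec, dotProduct, harqMatrix]
  have rowS (v : Fin (n + 1) → ℂ) (i : Fin n) :
      (harqMatrix p q θ R (n + 1)).mulVec v i.succ = v i.castSucc := by
    simp only [Matrix.mulVec, dotProduct, harqMatrix, Matrix.of_apply]
    rw [Finset.sum_eq_single i.castSucc]
    · simp
    · intro j _ hj
      have : (i : ℕ) ≠ j := fun h => hj (Fin.ext (by simp [h]))
      simp [this]
    · simp
  have key (v : Fin (n + 1) → ℂ) (hv : ∀ j : Fin (n + 1), v j = z⁻¹ ^ (j : ℕ) * v 0) :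
      (harqMatrix p q θ R (n + 1)).mulVec v 0 = (∑ j ∈ Finset.range (n + 1),
        ((harqCoeff p q θ R (n + 1) (j + 1) : ℝ) : ℂ) * z⁻¹ ^ (j + 1)) * (z * v 0) := by
    rw [row0, Finset.sum_range, Finset.sum_mul]
    refine Finset.sum_congr rfl fun j _ => ?_
    rw [hv j, pow_succ]
    field_simp
  constructor
  · intro h
    obtain ⟨v, hv⟩ := h.exists_hasEigenvector
    have hmul : (harqMatrix p q θ R (n + 1)).mulVec v = z • v := by
      simpa using hv.apply_eq_smul
    have hpow (j : Fin (n + 1)) : v j = z⁻¹ ^ (j : ℕ) * v 0 := by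
      induction j using Fin.induction with
      | zero => simp
      | succ i ih =>
        have := congrFun hmul i.succ
        rw [rowS, Pi.smul_apply, smul_eq_mul, ih] at this
        rw [Fin.val_succ, pow_succ]
        simp only [Fin.val_castSucc] at this
        field_simp at this ⊢
        rw [mul_comm, this]
        field_simp
    have h0 : v 0 ≠ 0 := fun h0 => hv.2 (funext fun j => by rw [hpow j, h0]; simp)
    have := congrFun hmul 0
    rw [key v hpow, Pi.smul_apply, smul_eq_mul] at this
    exact mul_right_cancel₀ (mul_ne_zero hz h0) (this.trans (one_mul _).symm)
  · intro h
    let v : Fin (n + 1) → ℂ := fun j => z⁻¹ ^ (j : ℕ)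
    refine Module.End.hasEigenvalue_of_hasEigenvector (x := v)
      ⟨Module.End.mem_eigenspace_iff.2 ?_, fun h0 => ?_⟩
    · rw [Matrix.toLin'_apply]
      funext i
      refine Fin.cases ?_ (fun i => ?_) i
      · rw [key v (fun j => by simp [v]), h]
        simp [v]
      · rw [rowS]
        simp [v, pow_succ]
        field_simp
    · have := congrFun h0 0
      simp [v] at this

theorem sum_harqCoeff (p : ℕ → ℝ) (q θ R : ℝ) {M : ℕ} (hM : 0 < M) (z : ℝ) :
    ∑ j ∈ Finset.range M, harqCoeff p q θ R M (j + 1) * z ^ (j + 1) =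
      ∑ j ∈ Finset.range M, p (j + 1) * Real.exp (-θ * R) * z ^ (j + 1) + q * z ^ M := by
  obtain ⟨n, rfl⟩ : ∃ n, M = n + 1 := ⟨M - 1, by omega⟩
  rw [Finset.sum_range_succ, Finset.sum_range_succ]
  have : ∀ j ∈ Finset.range n, harqCoeff p q θ R (n + 1) (j + 1) * z ^ (j + 1) =
      p (j + 1) * Real.exp (-θ * R) * z ^ (j + 1) := fun j hj => by
    have := (Finset.mem_range.1 hj).ne
    simp [harqCoeff, this]
  rw [Finset.sum_congr rfl this]
  simp [harqCoeff]
  ring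

/-! ### Convergence of the truncated spectral radii -/

section

variable {p q : ℕ → ℝ} {θ R T lam : ℝ}

theorem harqCoeff_nonneg (hT : 0 < T)
    (hp : ∀ m, p (m + 1) = Real.exp (-T) * (T ^ m / m.factorial)) (hq0 : ∀ m, 0 ≤ q m) (M j : ℕ) :
    0 ≤ harqCoeff p (q M) θ R M (j + 1) := by
  have h1 : 0 ≤ p (j + 1) := by rw [hp]; positivity
  unfold harqCoeff
  split_ifs with h
  · rw [← h]; exact add_nonneg (mul_nonneg h1 (Real.exp_pos _).le) (hq0 _)
  · positivity

/-- For an eigenvalue with `s < ‖z‖`, the triangle inequality and nonnegative coefficients would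
bound `1` by the sum at `s`, which is less than `1`. -/
theorem spectralRadius_harqMatrix_le (hT : 0 < T)
    (hp : ∀ m, p (m + 1) = Real.exp (-T) * (T ^ m / m.factorial)) (hq0 : ∀ m, 0 ≤ q m)
    {M : ℕ} (hM : 0 < M) {s : ℝ} (hs : 0 < s)
    (h : ∑ j ∈ Finset.range M, harqCoeff p (q M) θ R M (j + 1) * s⁻¹ ^ (j + 1) < 1) :
    spectralRadius ℂ (harqMatrix p (q M) θ R M) ≤ ENNReal.ofReal s := by
  refine iSup₂_le fun z hz => ?_
  rw [← enorm_eq_nnnorm, ← ofReal_norm]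
  refine ENNReal.ofReal_le_ofReal ?_
  by_contra! hlt
  have hz0 : z ≠ 0 := norm_pos_iff.1 (hs.trans hlt)
  rw [harqMatrix_mem_spectrum_iff _ _ _ _ hM hz0] at hz
  have h1 := congrArg norm hz
  rw [norm_one] at h1
  have h2 := norm_sum_le (Finset.range M) fun j =>
    ((harqCoeff p (q M) θ R M (j + 1) : ℝ) : ℂ) * z⁻¹ ^ (j + 1)
  rw [h1] at h2
  refine absurd (h2.trans_lt (lt_of_le_of_lt (Finset.sum_le_sum fun j _ => ?_) h)) (lt_irrefl _)
  rw [norm_mul, norm_pow, norm_inv, Complex.norm_real, Real.norm_of_nonneg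
    (harqCoeff_nonneg hT hp hq0 M j)]
  have := harqCoeff_nonneg (θ := θ) (R := R) hT hp hq0 M j
  gcongr

/-- The intermediate value theorem yields a real eigenvalue in `[s, t]`. -/
theorem le_spectralRadius_harqMatrix {c : ℝ} {M : ℕ} (hM : 0 < M) {s t : ℝ} (hs : 0 < s)
    (hst : s ≤ t)
    (h1 : 1 ≤ ∑ j ∈ Finset.range M, harqCoeff p c θ R M (j + 1) * s⁻¹ ^ (j + 1))
    (h2 : ∑ j ∈ Finset.range M, harqCoeff p c θ R M (j + 1) * t⁻¹ ^ (j + 1) ≤ 1) :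
    ENNReal.ofReal s ≤ spectralRadius ℂ (harqMatrix p c θ R M) := by
  have hcont : ContinuousOn (fun u : ℝ =>
      ∑ j ∈ Finset.range M, harqCoeff p c θ R M (j + 1) * u⁻¹ ^ (j + 1)) (Set.Icc s t) := by
    refine continuousOn_finsetSum _ fun j _ => ContinuousOn.mul continuousOn_const
      (ContinuousOn.pow (continuousOn_id.inv₀ fun u hu => (hs.trans_le hu.1).ne') _)
  obtain ⟨u, hu, hu1⟩ := intermediate_value_Icc' hst hcont ⟨h2, h1⟩
  have hu0 : 0 < u := hs.trans_le hu.1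
  have hmem : (u : ℂ) ∈ spectrum ℂ (harqMatrix p c θ R M) := by
    rw [harqMatrix_mem_spectrum_iff _ _ _ _ hM (by exact_mod_cast hu0.ne')]
    exact_mod_cast hu1
  refine le_trans ?_ (le_iSup₂_of_le (u : ℂ) hmem le_rfl)
  rw [← enorm_eq_nnnorm, ← ofReal_norm, Complex.norm_real, Real.norm_of_nonneg hu0.le]
  exact ENNReal.ofReal_le_ofReal hu.1

theorem isPersistentSpectralRadius_of_poisson (hT : 0 < T)
    (hp : ∀ m, p (m + 1) = Real.exp (-T) * (T ^ m / m.factorial)) (hq0 : ∀ m, 0 ≤ q m)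
    (hq : ∀ m, q m = 1 - ∑ j ∈ Finset.range m, p (j + 1))
    (hl0 : 0 < lam) (hl1 : lam < 1)
    (hl : Real.exp (-θ * R) * Real.exp (-T) * Real.exp (T * lam⁻¹) = lam) :
    IsPersistentSpectralRadius p q θ R lam := by
  set x := Real.exp (-θ * R) with hx
  have hx0 : 0 < x := Real.exp_pos _
  have hc : 0 < x * Real.exp (-T) := by positivity
  have hsum (z : ℂ) := hasSum_poisson_char T x z
  have hlam : x * Real.exp (-T) * lam⁻¹ * Real.exp (T * lam⁻¹) = 1 := by
    rw [mul_right_comm, hl, mul_inv_cancel₀ hl0.ne']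
  refine ⟨hl0, ⟨by exact_mod_cast hl0.ne', ?_⟩, fun z hz => ?_, ?_⟩
  · simp only [hp, ← hx]
    have := hsum (lam : ℂ)⁻¹
    convert this using 1
    exact_mod_cast hlam.symm
  -- Taking norms at a root bounds `1` by the real characteristic function at `‖z‖⁻¹`; by strict
  -- monotonicity that value is below `1` once `lam < ‖z‖`.
  · obtain ⟨hz0, hz1⟩ := hz
    simp only [hp, ← hx] at hz1
    have h1 := congrArg norm ((hsum z⁻¹).unique hz1)
    rw [norm_one, norm_mul, norm_mul, Complex.norm_real, Real.norm_of_nonneg hc.le, norm_inv] at h1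
    by_contra! hlt
    have hzp : 0 < ‖z‖ := norm_pos_iff.2 hz0
    have h2 := poisson_char_strictMono hT hc (inv_pos.2 hzp) (inv_strictAnti₀ hl0 hlt)
    rw [hlam] at h2
    refine absurd (h1.symm.le.trans_lt (lt_of_le_of_lt ?_ h2)) (lt_irrefl _)
    gcongr
    refine (Complex.norm_exp_le_exp_norm _).trans_eq ?_
    rw [norm_mul, norm_inv, Complex.norm_real, Real.norm_of_nonneg hT.le]
  · have hS (s : ℝ) : Tendsto (fun M : ℕ => ∑ j ∈ Finset.range M, p (j + 1) * x * s ^ (j + 1))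
        atTop (𝓝 (x * Real.exp (-T) * s * Real.exp (T * s))) := by
      simp only [hp]
      exact (hasSum_poisson_char_real T x s).tendsto_sum_nat
    have hqsum : HasSum (fun j => p (j + 1)) 1 := by
      have := hasSum_poisson_char_real T 1 1
      simp only [mul_one, one_pow, one_mul, ← Real.exp_add, neg_add_cancel, Real.exp_zero] at this
      simpa only [hp] using this
    -- `q M` is a tail of the success probabilities, so for `1 ≤ s` the product is at most the tail
    -- of a convergent series. Here `s` stands for an inverse radius, and `lam < 1` makes this range
    -- sufficient.
    have hQ {s : ℝ} (hs : 1 ≤ s) : Tendsto (fun M : ℕ => q M * s ^ M) atTop (𝓝 0) := by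
      have hs1 := (hasSum_poisson_char_real T 1 s).summable
      have h0 := tendsto_sum_nat_add
        (fun m : ℕ => (Real.exp (-T) * (T ^ m / m.factorial) * 1) * s ^ (m + 1))
      refine squeeze_zero (fun M => mul_nonneg (hq0 M) (by positivity)) (fun M => ?_) h0
      have hqM : q M = ∑' j, p (j + M + 1) := by
        have := hqsum.summable.sum_add_tsum_nat_add M
        rw [hqsum.tsum_eq] at this
        rw [hq]; linarith
      rw [hqM, ← tsum_mul_right]
      refine Summable.tsum_le_tsum (fun j => ?_)
        (((summable_nat_add_iff M).2 hqsum.summable).mul_right _) ((summable_nat_add_iff M).2 hs1)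
      rw [hp, mul_one]
      gcongr
      omega
    have hG {s : ℝ} (hs : 1 ≤ s) : Tendsto (fun M : ℕ =>
        ∑ j ∈ Finset.range M, harqCoeff p (q M) θ R M (j + 1) * s ^ (j + 1)) atTop
        (𝓝 (x * Real.exp (-T) * s * Real.exp (T * s))) := by
      have := (hS s).add (hQ hs)
      rw [add_zero] at this
      refine this.congr' ?_
      filter_upwards [eventually_gt_atTop 0] with M hM
      rw [sum_harqCoeff _ _ _ _ hM]
    have upper {s : ℝ} (hs : lam < s) (hs1 : s < 1) : ∀ᶠ M : ℕ in atTop,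
        ∑ j ∈ Finset.range M, harqCoeff p (q M) θ R M (j + 1) * s⁻¹ ^ (j + 1) < 1 := by
      have hs0 := hl0.trans hs
      refine (hG ((one_le_inv₀ hs0).2 hs1.le)).eventually_lt_const ?_
      rw [← hlam]
      exact poisson_char_strictMono hT hc (inv_pos.2 hs0) (inv_strictAnti₀ hl0 hs)
    have lower {s : ℝ} (hs0 : 0 < s) (hs : s < lam) : ∀ᶠ M : ℕ in atTop,
        1 < ∑ j ∈ Finset.range M, harqCoeff p (q M) θ R M (j + 1) * s⁻¹ ^ (j + 1) := by
      refine (hG ((one_le_inv₀ hs0).2 (hs.trans hl1).le)).eventually_const_lt ?_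
      rw [← hlam]
      exact poisson_char_strictMono hT hc (inv_pos.2 hl0) (inv_strictAnti₀ hs0 hs)
    rw [tendsto_order]
    constructor
    · intro a ha
      obtain ⟨r, hr0, hra, hr⟩ := ENNReal.lt_iff_exists_real_btwn.1 ha
      have hrl : r < lam := (ENNReal.ofReal_lt_ofReal_iff hl0).1 hr
      obtain ⟨s, hs1, hs2⟩ := exists_between (max_lt hrl hl0)
      -- `t` is the right end of the interval on which a real eigenvalue is sought; it stays below
      -- `1` so that `hG` applies to `t⁻¹`.
      obtain ⟨t, ht1, ht2⟩ := exists_between hl1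
      have hs0 : 0 < s := (le_max_right _ _).trans_lt hs1
      filter_upwards [lower hs0 hs2, upper ht1 ht2, eventually_gt_atTop 0] with M h1 h2 hM
      refine hra.trans_le (le_trans (ENNReal.ofReal_le_ofReal ((le_max_left _ _).trans hs1.le))
        (le_spectralRadius_harqMatrix hM hs0 (hs2.trans ht1).le h1.le h2.le))
    · intro b hb
      obtain ⟨r, hr0, hr, hrb⟩ := ENNReal.lt_iff_exists_real_btwn.1 hb
      have hrl : lam < r := (ENNReal.ofReal_lt_ofReal_iff_of_nonneg hl0.le).1 hr
      obtain ⟨s, hs1, hs2⟩ := exists_between (lt_min hrl hl1)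
      filter_upwards [upper hs1 (hs2.trans_le (min_le_right _ _)), eventually_gt_atTop 0] with M h hM
      exact lt_of_le_of_lt ((spectralRadius_harqMatrix_le hT hp hq0 hM (hl0.trans hs1) h).trans
        (ENNReal.ofReal_le_ofReal (hs2.le.trans (min_le_left _ _)))) hrb

end

/-! ### Integration against the exponential law -/

theorem lintegral_expMeasure_one {f : ℝ → ENNReal} (hf : Measurable f) :
    ∫⁻ y, f y ∂(expMeasure 1) = ∫⁻ y in Set.Ici 0, ENNReal.ofReal (Real.exp (-y)) * f y := by
  have h : expMeasure 1 = volume.withDensity (exponentialPDF 1) := rfl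
  have hm : Measurable (exponentialPDF 1) := (measurable_exponentialPDFReal 1).ennreal_ofReal
  rw [h, lintegral_withDensity_eq_lintegral_mul _ hm hf, ← lintegral_indicator measurableSet_Ici]
  refine lintegral_congr fun y => ?_
  by_cases hy : 0 ≤ y
  · simp [exponentialPDF_eq, hy]
  · simp [exponentialPDF_eq, hy]

/-- Common form of the one-slot expectations: `b` is the gain still missing, and `c` the value after
decoding. Nonnegativity is asked only before `b` because powers of `b - y` may change sign there. -/
theorem lintegral_expMeasure_one_ite {b c : ℝ} (hb : 0 ≤ b) (hc : 0 ≤ c) {f : ℝ → ℝ}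
    (hf : Continuous f) (hf0 : ∀ y, 0 ≤ y → y < b → 0 ≤ f y) :
    ∫⁻ y, ENNReal.ofReal (if y < b then f y else c) ∂(expMeasure 1) =
      ENNReal.ofReal ((∫ y in (0 : ℝ)..b, Real.exp (-y) * f y) + c * Real.exp (-b)) := by
  have hm : Measurable fun y => ENNReal.ofReal (if y < b then f y else c) :=
    (Measurable.ite measurableSet_Iio hf.measurable measurable_const).ennreal_ofReal
  rw [lintegral_expMeasure_one hm, ← Set.Ico_union_Ici_eq_Ici hb,
    lintegral_union measurableSet_Ici
      (Set.disjoint_left.2 fun y hy hy' => (hy.2.trans_le hy').false)]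
  have hcf : Continuous fun y => Real.exp (-y) * f y := by fun_prop
  have hint : 0 ≤ ∫ y in (0 : ℝ)..b, Real.exp (-y) * f y := by
    rw [intervalIntegral.integral_of_le hb, integral_Ioc_eq_integral_Ioo]
    exact setIntegral_nonneg measurableSet_Ioo fun y hy =>
      mul_nonneg (Real.exp_pos _).le (hf0 y hy.1.le hy.2)
  rw [ENNReal.ofReal_add hint (by positivity)]
  congr 1
  · rw [intervalIntegral.integral_of_le hb, integral_Ioc_eq_integral_Ioo,
      ← integral_Ico_eq_integral_Ioo, ofReal_integral_eq_lintegral_ofReal]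
    · refine setLIntegral_congr_fun measurableSet_Ico fun y hy => ?_
      simp only [if_pos hy.2, ENNReal.ofReal_mul (Real.exp_pos _).le]
    · exact (hcf.integrableOn_Icc (a := 0) (b := b)).mono_set Set.Ico_subset_Icc_self
    · exact (ae_restrict_iff' measurableSet_Ico).2 (ae_of_all _ fun y hy =>
        mul_nonneg (Real.exp_pos _).le (hf0 y hy.1 hy.2))
  · rw [mul_comm, ENNReal.ofReal_mul (Real.exp_pos _).le, ← integral_exp_neg_Ioi,
      ← integral_Ici_eq_integral_Ioi, ofReal_integral_eq_lintegral_ofReal,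
      ← lintegral_mul_const _ (by fun_prop)]
    · refine setLIntegral_congr_fun measurableSet_Ici fun y hy => ?_
      simp only [if_neg (not_lt.2 (Set.mem_Ici.1 hy))]
    · rw [← IntegrableOn, integrableOn_Ici_iff_integrableOn_Ioi]
      simpa using exp_neg_integrableOn_Ioi b one_pos
    · exact ae_of_all _ fun y => (Real.exp_pos _).le

/-- The probability that a unit rate Poisson process has exactly `j` points in `[s, T)`. -/
noncomputable def poissonRemaining (T : ℝ) (j : ℕ) (s : ℝ) : ℝ :=
  if s < T then Real.exp (-(T - s)) * ((T - s) ^ j / j.factorial) else 0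

theorem poissonRemaining_nonneg (T : ℝ) (j : ℕ) (s : ℝ) : 0 ≤ poissonRemaining T j s := by
  unfold poissonRemaining
  split_ifs with h
  · have := (sub_pos.2 h).le
    positivity
  · exact le_rfl

theorem measurable_poissonRemaining (T : ℝ) (j : ℕ) : Measurable (poissonRemaining T j) :=
  Measurable.ite measurableSet_Iio (by fun_prop) measurable_const

/-- Conditioning on the first arrival after `s`: the exponentials multiply to the constant `exp (-(T
- s))`, so only a power of `T - s - y` is integrated. -/
theorem lintegral_poissonRemaining (T : ℝ) (j : ℕ) (s : ℝ) :
    ∫⁻ y, ENNReal.ofReal (poissonRemaining T j (s + y)) ∂(expMeasure 1) =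
      ENNReal.ofReal (poissonRemaining T (j + 1) s) := by
  rcases lt_or_ge s T with hs | hs
  · have hcond (y : ℝ) : s + y < T ↔ y < T - s := by constructor <;> intro h <;> linarith
    simp only [poissonRemaining, hcond, if_pos hs]
    rw [lintegral_expMeasure_one_ite (sub_pos.2 hs).le le_rfl
      (f := fun y => Real.exp (-(T - (s + y))) * ((T - (s + y)) ^ j / j.factorial)) (by fun_prop)
      (fun y _ hy => by
        have : 0 ≤ T - (s + y) := by linarith
        positivity)]
    congr 1
    have hd : ∀ y ∈ Set.uIcc 0 (T - s), HasDerivAt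
        (fun y => -Real.exp (-(T - s)) * ((T - s - y) ^ (j + 1) / (j + 1).factorial))
        (Real.exp (-y) * (Real.exp (-(T - (s + y))) * ((T - (s + y)) ^ j / j.factorial))) y := by
      intro y _
      have h1 : HasDerivAt (fun y => T - s - y) (-1) y := (hasDerivAt_id y).const_sub (T - s)
      have h2 := ((h1.pow (j + 1)).div_const ((j + 1).factorial : ℝ)).const_mul
        (-Real.exp (-(T - s)))
      refine h2.congr_deriv ?_
      rw [← mul_assoc, ← Real.exp_add, Nat.factorial_succ]
      have e : -y + -(T - (s + y)) = -(T - s) := by ring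
      rw [e]
      push_cast
      have : (j.factorial : ℝ) ≠ 0 := by positivity
      field_simp
      simp [sub_sub]
    rw [intervalIntegral.integral_eq_sub_of_hasDerivAt hd
      ((Continuous.intervalIntegrable (by fun_prop) _ _))]
    simp
  · rw [poissonRemaining, if_neg hs.not_gt, ENNReal.ofReal_zero, lintegral_expMeasure_one
      (f := fun y => ENNReal.ofReal (poissonRemaining T j (s + y)))
      ((measurable_poissonRemaining T j).comp (measurable_const_add s)).ennreal_ofReal]
    rw [setLIntegral_congr_fun (g := fun _ => 0) measurableSet_Ici fun y hy => ?_]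
    · simp
    · have : ¬ s + y < T := not_lt.2 (by linarith [Set.mem_Ici.1 hy])
      simp [poissonRemaining, this]

/-! ### The law of the number of transmissions -/

section

variable {Ω : Type*} [MeasurableSpace Ω] {μ : Measure Ω} [IsProbabilityMeasure μ]

theorem lintegral_prodMk_of_indepFun {α : Type*} [MeasurableSpace α] {X : Ω → α} {Y : Ω → ℝ}
    {ν : Measure ℝ} (hX : AEMeasurable X μ) (hY : HasLaw Y ν μ) (h : IndepFun X Y μ)
    {F : α × ℝ → ENNReal} (hF : Measurable F) :
    ∫⁻ ω, F (X ω, Y ω) ∂μ = ∫⁻ ω, ∫⁻ y, F (X ω, y) ∂ν ∂μ := by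
  have : IsProbabilityMeasure ν := hY.isProbabilityMeasure_iff.1 inferInstance
  have hmap := (indepFun_iff_map_prod_eq_prod_map_map hX hY.aemeasurable).1 h
  rw [hY.map_eq] at hmap
  rw [← lintegral_map' hF.aemeasurable (hX.prodMk hY.aemeasurable), hmap, lintegral_prod _ hF.aemeasurable,
    lintegral_map' hF.lintegral_prod_right'.aemeasurable hX]

end

section

variable {Ω : Type*} [MeasurableSpace Ω] {μ : Measure Ω}
  {g : ℕ → Ω → ℝ} {R Γ T : ℝ}

/-- `Real.logb` sees only absolute values, so the threshold form of decoding requires nonnegative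
gain sums. -/
theorem IsBlockRayleighFading.ae_nonneg (hg : IsBlockRayleighFading μ g) :
    ∀ᵐ ω ∂μ, ∀ i, 0 ≤ g i ω := by
  refine ae_all_iff.2 fun i => ((hg.law i).ae_iff (p := fun x => 0 ≤ x)
    (measurableSet_setOfPred.1 measurableSet_Ici)).2 ?_
  have := lintegral_expMeasure_one (f := (Set.Iio (0 : ℝ)).indicator 1)
    (measurable_one.indicator measurableSet_Iio)
  rw [lintegral_indicator_one measurableSet_Iio, setLIntegral_congr_fun (g := fun _ => 0)
    measurableSet_Ici (fun y hy => by simp [Set.mem_Ici.1 hy])] at this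
  rw [ae_iff]
  simpa using! this

theorem le_combinedInformation_iff (hΓ : 0 < Γ) (hT : T = ((2 : ℝ) ^ R - 1) / Γ) {s : ℝ}
    (hs : 0 ≤ s) : R ≤ combinedInformation Γ s ↔ T ≤ s := by
  rw [combinedInformation, Real.le_logb_iff_rpow_le one_lt_two (by positivity), hT, div_le_iff₀ hΓ]
  constructor <;> intro h <;> linarith

theorem measurable_combinedInformation (Γ : ℝ) : Measurable (combinedInformation Γ) := by
  unfold combinedInformation Real.logb
  fun_prop

theorem IsBlockRayleighFading.aemeasurable_sum (hg : IsBlockRayleighFading μ g) (m : ℕ) :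
    AEMeasurable (fun ω => ∑ i ∈ Finset.range m, g i ω) μ :=
  Finset.aemeasurable_fun_sum _ fun i _ => (hg.law i).aemeasurable

theorem IsBlockRayleighFading.lintegral_poissonRemaining_sum [IsProbabilityMeasure μ] (hg : IsBlockRayleighFading μ g)
    (T : ℝ) (m j : ℕ) :
    ∫⁻ ω, ENNReal.ofReal (poissonRemaining T j (∑ i ∈ Finset.range m, g i ω)) ∂μ =
      ENNReal.ofReal (poissonRemaining T (j + m) 0) := by
  induction m generalizing j with
  | zero => simp
  | succ m ih =>
    have hind : IndepFun (fun ω => ∑ i ∈ Finset.range m, g i ω) (g m) μ := by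
      have := hg.indep.indepFun_sum_range_succ₀ (fun i => (hg.law i).aemeasurable) m
      convert! this using 1
      ext ω; simp
    have := lintegral_prodMk_of_indepFun (hg.aemeasurable_sum m) (hg.law m) hind
      (F := fun p => ENNReal.ofReal (poissonRemaining T j (p.1 + p.2)))
      ((measurable_poissonRemaining T j).comp (measurable_fst.add measurable_snd)).ennreal_ofReal
    simp only [Finset.sum_range_succ]
    rw [this]
    simp only [lintegral_poissonRemaining]
    rw [ih, add_right_comm, add_assoc]

theorem rrFailProb_eq_lintegral [IsProbabilityMeasure μ] (hg : IsBlockRayleighFading μ g) (hΓ : 0 < Γ)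
    (hT : T = ((2 : ℝ) ^ R - 1) / Γ) (m : ℕ) :
    ENNReal.ofReal (rrFailProb μ g R Γ m) =
      ∫⁻ ω, (Set.Iio T).indicator 1 (∑ i ∈ Finset.range m, g i ω) ∂μ := by
  have hm : NullMeasurableSet
      {ω | combinedInformation Γ (∑ i ∈ Finset.range m, g i ω) < R} μ :=
    nullMeasurableSet_lt ((measurable_combinedInformation Γ).comp_aemeasurable
      (hg.aemeasurable_sum m)) aemeasurable_const
  rw [rrFailProb, ofReal_measureReal, ← lintegral_indicator_one₀ hm]
  refine lintegral_congr_ae ?_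
  filter_upwards [hg.ae_nonneg] with ω hω
  have h := le_combinedInformation_iff hΓ hT (Finset.sum_nonneg fun i (_ : i ∈ Finset.range m) => hω i)
  have h' := not_congr h
  rw [not_le, not_le] at h'
  simp only [Set.indicator_apply, Set.mem_ofPred_eq, Set.mem_Iio, h', Pi.one_apply]

theorem rrFailProb_zero [IsProbabilityMeasure μ] (hR : 0 < R) : rrFailProb μ g R Γ 0 = 1 := by
  simp [rrFailProb, combinedInformation, hR]

/-- The number of transmissions used for a packet is one plus a Poisson variable of mean `T`. -/
theorem rrSuccessProb_succ [IsProbabilityMeasure μ] (hg : IsBlockRayleighFading μ g) (hR : 0 < R) (hΓ : 0 < Γ)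
    (hT : T = ((2 : ℝ) ^ R - 1) / Γ) (m : ℕ) :
    rrSuccessProb μ g R Γ (m + 1) = Real.exp (-T) * (T ^ m / m.factorial) := by
  have hT0 : 0 < T := by
    rw [hT]
    exact div_pos (sub_pos.2 (Real.one_lt_rpow one_lt_two hR)) hΓ
  -- Given a sum `s < T` of the first `m` gains, the next slot fails with probability `1 - exp (-(T
  -- - s))` and succeeds with probability `exp (-(T - s))`, which is `poissonRemaining T 0 s`.
  have hsum : ENNReal.ofReal (rrFailProb μ g R Γ m) = ENNReal.ofReal (rrFailProb μ g R Γ (m + 1)) +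
      ENNReal.ofReal (poissonRemaining T m 0) := by
    have h0 := hg.lintegral_poissonRemaining_sum T m 0
    rw [zero_add] at h0
    rw [← h0]
    have hind : IndepFun (fun ω => ∑ i ∈ Finset.range m, g i ω) (g m) μ := by
      have := hg.indep.indepFun_sum_range_succ₀ (fun i => (hg.law i).aemeasurable) m
      convert! this using 1
      ext ω; simp
    have hI : Measurable ((Set.Iio T).indicator (1 : ℝ → ENNReal)) :=
      measurable_one.indicator measurableSet_Iio
    have := lintegral_prodMk_of_indepFun (hg.aemeasurable_sum m) (hg.law m) hind
      (F := fun p => (Set.Iio T).indicator 1 (p.1 + p.2))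
      (hI.comp (measurable_fst.add measurable_snd))
    rw [rrFailProb_eq_lintegral hg hΓ hT, rrFailProb_eq_lintegral hg hΓ hT]
    simp only [Finset.sum_range_succ]
    have hpm : AEMeasurable
        (fun ω => ENNReal.ofReal (poissonRemaining T 0 (∑ i ∈ Finset.range m, g i ω))) μ :=
      ((measurable_poissonRemaining T 0).comp_aemeasurable (hg.aemeasurable_sum m)).ennreal_ofReal
    rw [this, ← lintegral_add_right' _ hpm]
    refine lintegral_congr fun ω => ?_
    generalize ∑ i ∈ Finset.range m, g i ω = s
    rcases lt_or_ge s T with hs | hs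
    · have := lintegral_expMeasure_one_ite (sub_pos.2 hs).le le_rfl (f := fun _ => 1)
        continuous_const (fun _ _ _ => zero_le_one)
      have e (y : ℝ) : (Set.Iio T).indicator (1 : ℝ → ENNReal) (s + y) =
          ENNReal.ofReal (if y < T - s then 1 else 0) := by
        by_cases h : y < T - s
        · have : s + y < T := by linarith
          simp [h, this]
        · have : ¬ s + y < T := by linarith
          simp [h, this]
      simp only [e]
      have hexp : ∫ y in (0 : ℝ)..(T - s), Real.exp (-y) = 1 - Real.exp (-(T - s)) := by
        rw [intervalIntegral.integral_comp_neg, integral_exp, neg_zero, Real.exp_zero]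
      simp only [mul_one, zero_mul, add_zero, hexp] at this
      rw [this, ← ENNReal.ofReal_add _ (poissonRemaining_nonneg _ _ _)]
      · simp [poissonRemaining, hs]
      · exact sub_nonneg.2 (Real.exp_le_one_iff.2 (by linarith))
    · have hz : ∀ y ∈ Set.Ici (0 : ℝ), ENNReal.ofReal (Real.exp (-y)) *
          (Set.Iio T).indicator (1 : ℝ → ENNReal) (s + y) = 0 := fun y hy => by
        have : T ≤ s + y := by linarith [Set.mem_Ici.1 hy]
        simp [this]
      rw [lintegral_expMeasure_one (f := fun y => (Set.Iio T).indicator 1 (s + y)) (hI.comp (measurable_const_add s)),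
        setLIntegral_congr_fun (g := fun _ => 0) measurableSet_Ici hz]
      simp [poissonRemaining, hs.not_gt]
  have hp : poissonRemaining T m 0 = Real.exp (-T) * (T ^ m / m.factorial) := by
    simp [poissonRemaining, hT0]
  have hq (k : ℕ) : 0 ≤ rrFailProb μ g R Γ k := measureReal_nonneg
  rw [← ENNReal.ofReal_add (hq _) (poissonRemaining_nonneg _ _ _),
    ENNReal.ofReal_eq_ofReal_iff (hq _)
      (add_nonneg (hq _) (poissonRemaining_nonneg _ _ _))] at hsum
  rw [rrSuccessProb, Nat.add_sub_cancel, hsum, hp]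
  ring

theorem rrFailProb_eq_one_sub [IsProbabilityMeasure μ] (hR : 0 < R) (m : ℕ) :
    rrFailProb μ g R Γ m = 1 - ∑ j ∈ Finset.range m, rrSuccessProb μ g R Γ (j + 1) := by
  have := Finset.sum_range_sub' (rrFailProb μ g R Γ) m
  simp only [rrSuccessProb, Nat.add_sub_cancel]
  rw [this, rrFailProb_zero hR]
  ring

end

/-! ### The Markov chain of HARQ states and its growth rate -/

theorem rrState_congr (R Γ : ℝ) {g g' : ℕ → ℝ} {k : ℕ} (h : ∀ i < k, g i = g' i) :
    rrState R Γ g k = rrState R Γ g' k := by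
  induction k with
  | zero => rfl
  | succ k ih =>
    have := ih fun i hi => h i (hi.trans k.lt_succ_self)
    simp only [rrState, this, h k k.lt_succ_self]

/-- One timeslot of persistent repetition-redundancy HARQ. -/
noncomputable def rrStep (R Γ : ℝ) (p : (ℕ × ℝ) × ℝ) : ℕ × ℝ :=
  open Classical in
  if R ≤ combinedInformation Γ (p.1.2 + p.2) then (p.1.1 + 1, 0) else (p.1.1, p.1.2 + p.2)

theorem rrState_succ (R Γ : ℝ) (g : ℕ → ℝ) (k : ℕ) :
    rrState R Γ g (k + 1) = rrStep R Γ (rrState R Γ g k, g k) := rfl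

theorem measurable_rrStep (R Γ : ℝ) : Measurable (rrStep R Γ) := by
  have hc := measurable_combinedInformation Γ
  refine Measurable.ite (measurableSet_le measurable_const (hc.comp (by fun_prop))) ?_ ?_
  · exact ((measurable_from_top (f := fun n : ℕ => n + 1)).comp (by fun_prop)).prodMk
      measurable_const
  · fun_prop

theorem measurable_rrState (R Γ : ℝ) (k : ℕ) :
    Measurable fun g : ℕ → ℝ => rrState R Γ g k := by
  induction k with
  | zero => exact measurable_const
  | succ k ih => exact (measurable_rrStep R Γ).comp (ih.prodMk (measurable_pi_apply k))

section

variable {Ω : Type*} [MeasurableSpace Ω] {μ : Measure Ω} {g : ℕ → Ω → ℝ} {R Γ T : ℝ}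

theorem IsBlockRayleighFading.aemeasurable_rrState (hg : IsBlockRayleighFading μ g) (R Γ : ℝ)
    (k : ℕ) : AEMeasurable (fun ω => rrState R Γ (fun i => g i ω) k) μ :=
  (measurable_rrState R Γ k).comp_aemeasurable
    (aemeasurable_pi_lambda _ fun i => (hg.law i).aemeasurable)

theorem IsBlockRayleighFading.indepFun_rrState (hg : IsBlockRayleighFading μ g) (R Γ : ℝ)
    (k : ℕ) : IndepFun (fun ω => rrState R Γ (fun i => g i ω) k) (g k) μ := by
  have h := hg.indep.indepFun_finset₀ (Finset.range k) {k} (by simp)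
    fun i => (hg.law i).aemeasurable
  -- Padding by zeros is harmless: the state after `k` slots reads only the gains with index below
  -- `k`.
  let e : (Finset.range k → ℝ) → ℕ → ℝ := fun x i =>
    if hi : i ∈ Finset.range k then x ⟨i, hi⟩ else 0
  have he : Measurable e := measurable_pi_lambda _ fun i => by
    by_cases hi : i ∈ Finset.range k
    · simpa only [e, hi, dite_true] using measurable_pi_apply _
    · simp only [e, hi, dite_false, measurable_const]
  have hk : Measurable fun x : ({k} : Finset ℕ) → ℝ => x ⟨k, Finset.mem_singleton_self k⟩ := by
    fun_prop
  have := h.comp ((measurable_rrState R Γ k).comp he) hk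
  convert! this using 1
  ext1 ω
  exact rrState_congr R Γ fun i hi => by simp [e, hi]

theorem rrState_mem_Ico (hΓ : 0 < Γ) (hT : T = ((2 : ℝ) ^ R - 1) / Γ) (hT0 : 0 < T)
    {g : ℕ → ℝ} (hg : ∀ i, 0 ≤ g i) (k : ℕ) : (rrState R Γ g k).2 ∈ Set.Ico 0 T := by
  induction k with
  | zero => exact ⟨le_rfl, hT0⟩
  | succ k ih =>
    have hs := add_nonneg ih.1 (hg k)
    rw [rrState_succ, rrStep]
    split_ifs with h
    · exact ⟨le_rfl, hT0⟩
    · exact ⟨hs, not_le.1 fun h' => h ((le_combinedInformation_iff hΓ hT hs).2 h')⟩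

/-- The eigenfunction property: `s ↦ exp (s (1 - 1 / lam))` is an eigenfunction, of eigenvalue
`lam`, of the transition operator weighted by `x` for each decoded packet. -/
theorem lintegral_rrStep (hΓ : 0 < Γ) (hT : T = ((2 : ℝ) ^ R - 1) / Γ) {x lam : ℝ} (hx : 0 < x)
    (hl0 : 0 < lam) (hl : x * Real.exp (-T) * Real.exp (T * lam⁻¹) = lam) (n : ℕ) {s : ℝ}
    (hs : s ∈ Set.Ico 0 T) :
    ∫⁻ y, ENNReal.ofReal (x ^ (rrStep R Γ ((n, s), y)).1 *
        Real.exp ((rrStep R Γ ((n, s), y)).2 * (1 - lam⁻¹))) ∂(expMeasure 1) =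
      ENNReal.ofReal lam * ENNReal.ofReal (x ^ n * Real.exp (s * (1 - lam⁻¹))) := by
  have hb : 0 ≤ T - s := by linarith [hs.2]
  have hF : Measurable fun p : ℕ × ℝ =>
      ENNReal.ofReal (x ^ p.1 * Real.exp (p.2 * (1 - lam⁻¹))) := by fun_prop
  rw [lintegral_expMeasure_one (f := fun y => ENNReal.ofReal (x ^ (rrStep R Γ ((n, s), y)).1 *
        Real.exp ((rrStep R Γ ((n, s), y)).2 * (1 - lam⁻¹))))
      (hF.comp ((measurable_rrStep R Γ).comp measurable_prodMk_left))]
  have hcongr : ∀ y ∈ Set.Ici (0 : ℝ), ENNReal.ofReal (Real.exp (-y)) *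
        ENNReal.ofReal (x ^ (rrStep R Γ ((n, s), y)).1 *
        Real.exp ((rrStep R Γ ((n, s), y)).2 * (1 - lam⁻¹))) =
      ENNReal.ofReal (Real.exp (-y)) * ENNReal.ofReal
        (if y < T - s then x ^ n * Real.exp ((s + y) * (1 - lam⁻¹)) else x ^ (n + 1)) := by
    intro y hy
    have h := le_combinedInformation_iff hΓ hT (add_nonneg hs.1 hy)
    by_cases hys : y < T - s
    · have : ¬ T ≤ s + y := by linarith
      simp only [rrStep, h, this, if_false, hys, if_true]
    · have : T ≤ s + y := by linarith
      simp [rrStep, h, this, hys]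
  rw [setLIntegral_congr_fun measurableSet_Ici hcongr, ← lintegral_expMeasure_one
    (f := fun y => ENNReal.ofReal
        (if y < T - s then x ^ n * Real.exp ((s + y) * (1 - lam⁻¹)) else x ^ (n + 1)))
      (Measurable.ite measurableSet_Iio (by fun_prop) measurable_const).ennreal_ofReal,
    lintegral_expMeasure_one_ite hb (by positivity)
      (f := fun y => x ^ n * Real.exp ((s + y) * (1 - lam⁻¹))) (by fun_prop)
      (fun _ _ _ => by positivity), ← ENNReal.ofReal_mul hl0.le]
  congr 1
  -- The integrand is a constant times `exp (-y / lam)`. The lower endpoint of its antiderivative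
  -- produces `lam` times the eigenfunction.
  have hd : ∀ y ∈ Set.uIcc 0 (T - s), HasDerivAt
      (fun y => -(lam * x ^ n * Real.exp (s * (1 - lam⁻¹)) * Real.exp (-lam⁻¹ * y)))
      (Real.exp (-y) * (x ^ n * Real.exp ((s + y) * (1 - lam⁻¹)))) y := by
    intro y _
    have h1 := ((((hasDerivAt_id y).const_mul (-lam⁻¹)).exp).const_mul
      (lam * x ^ n * Real.exp (s * (1 - lam⁻¹)))).neg
    refine h1.congr_deriv ?_
    have e : Real.exp ((s + y) * (1 - lam⁻¹)) =
        Real.exp (s * (1 - lam⁻¹)) * Real.exp (-lam⁻¹ * y) * Real.exp y := by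
      rw [← Real.exp_add, ← Real.exp_add]; ring_nf
    have e2 : Real.exp (-y) * Real.exp y = 1 := by rw [← Real.exp_add]; simp
    rw [e]
    simp only [id, mul_one]
    have : lam * lam⁻¹ = 1 := mul_inv_cancel₀ hl0.ne'
    linear_combination (x ^ n * Real.exp (s * (1 - lam⁻¹)) * Real.exp (-lam⁻¹ * y)) * (this - e2)
  rw [intervalIntegral.integral_eq_sub_of_hasDerivAt hd
    (Continuous.intervalIntegrable (by fun_prop) _ _)]
  -- The upper endpoint cancels the contribution of decoding; this is precisely the characteristic
  -- equation `hl`.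
  have e : lam * Real.exp (s * (1 - lam⁻¹)) * Real.exp (-lam⁻¹ * (T - s)) =
      x * Real.exp (-(T - s)) := by
    have : x * Real.exp (-(T - s)) = x * Real.exp (-T) * Real.exp (T * lam⁻¹) *
        (Real.exp (s * (1 - lam⁻¹)) * Real.exp (-lam⁻¹ * (T - s))) := by
      simp only [mul_assoc, ← Real.exp_add]; ring_nf
    rw [this, hl, mul_assoc]
  simp only [mul_zero, Real.exp_zero, mul_one]
  rw [pow_succ]
  linear_combination (-(x ^ n)) * e

/-- Iterates the eigenfunction property from the state `(0, 0)`, where the weighted eigenfunction is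
`1`; the next gain is independent of the current state. -/
theorem IsBlockRayleighFading.lintegral_rrState [IsProbabilityMeasure μ]
    (hg : IsBlockRayleighFading μ g) (hΓ : 0 < Γ)
    (hT : T = ((2 : ℝ) ^ R - 1) / Γ) (hT0 : 0 < T) {x lam : ℝ} (hx : 0 < x) (hl0 : 0 < lam)
    (hl : x * Real.exp (-T) * Real.exp (T * lam⁻¹) = lam) (k : ℕ) :
    ∫⁻ ω, ENNReal.ofReal (x ^ (rrState R Γ (fun i => g i ω) k).1 *
      Real.exp ((rrState R Γ (fun i => g i ω) k).2 * (1 - lam⁻¹))) ∂μ =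
      ENNReal.ofReal lam ^ k := by
  induction k with
  | zero => simp [rrState]
  | succ k ih =>
    have hF : Measurable fun p : ℕ × ℝ =>
      ENNReal.ofReal (x ^ p.1 * Real.exp (p.2 * (1 - lam⁻¹))) := by fun_prop
    simp only [rrState_succ]
    rw [lintegral_prodMk_of_indepFun (hg.aemeasurable_rrState R Γ k) (hg.law k)
      (hg.indepFun_rrState R Γ k) (F := fun p => ENNReal.ofReal (x ^ (rrStep R Γ p).1 *
        Real.exp ((rrStep R Γ p).2 * (1 - lam⁻¹)))) (hF.comp (measurable_rrStep R Γ)),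
      pow_succ', ← ih, ← lintegral_const_mul' _ _ ENNReal.ofReal_ne_top]
    refine lintegral_congr_ae ?_
    filter_upwards [hg.ae_nonneg] with ω hω
    exact lintegral_rrStep hΓ hT hx hl0 hl _ (rrState_mem_Ico hΓ hT hT0 hω k)

theorem IsBlockRayleighFading.hasEffectiveCapacity [IsProbabilityMeasure μ]
    (hg : IsBlockRayleighFading μ g) {θ : ℝ} (hR : 0 < R) (hθ : 0 < θ) (hΓ : 0 < Γ)
    (hT : T = ((2 : ℝ) ^ R - 1) / Γ) (hT0 : 0 < T) {lam : ℝ} (hl0 : 0 < lam) (hl1 : lam < 1)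
    (hl : Real.exp (-θ * R) * Real.exp (-T) * Real.exp (T * lam⁻¹) = lam) :
    HasEffectiveCapacity μ θ (fun k ω => R * (rrPackets R Γ (fun i => g i ω) k : ℝ))
      (-Real.log lam / θ) := by
  set x := Real.exp (-θ * R) with hx
  have hx0 : 0 < x := Real.exp_pos _
  have hx1 : x ≤ 1 := Real.exp_le_one_iff.2 (by nlinarith)
  have hpow (k : ℕ) (ω : Ω) : Real.exp (-θ * (R * (rrPackets R Γ (fun i => g i ω) k : ℝ))) =
      x ^ (rrState R Γ (fun i => g i ω) k).1 := by
    rw [hx, ← Real.exp_nat_mul, rrPackets]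
    ring_nf
  have hm (k : ℕ) : AEMeasurable (fun ω => x ^ (rrState R Γ (fun i => g i ω) k).1) μ :=
    ((measurable_from_top (f := fun n : ℕ => x ^ n)).comp measurable_fst).comp_aemeasurable
      (hg.aemeasurable_rrState R Γ k)
  have hint (k : ℕ) : Integrable (fun ω => x ^ (rrState R Γ (fun i => g i ω) k).1) μ :=
    Integrable.of_bound (hm k).aestronglyMeasurable 1 (ae_of_all _ fun ω => by
      rw [Real.norm_of_nonneg (by positivity)]
      exact pow_le_one₀ hx0.le hx1)
  have hinv : 1 - lam⁻¹ ≤ 0 := by linarith [(one_lt_inv₀ hl0).2 hl1]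
  -- On `[0, T)` the eigenfunction is decreasing, bounded above by `1` and below by `c`.
  set c := Real.exp (T * (1 - lam⁻¹)) with hc
  have hc0 : 0 < c := Real.exp_pos _
  have hE (k : ℕ) : ∫ ω, x ^ (rrState R Γ (fun i => g i ω) k).1 *
      Real.exp ((rrState R Γ (fun i => g i ω) k).2 * (1 - lam⁻¹)) ∂μ = lam ^ k := by
    rw [integral_eq_lintegral_of_nonneg_ae (ae_of_all _ fun ω => by positivity),
      hg.lintegral_rrState hΓ hT hT0 hx0 hl0 hl, ENNReal.toReal_pow, ENNReal.toReal_ofReal hl0.le]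
    exact ((hm k).mul (Real.measurable_exp.comp_aemeasurable
      (((hg.aemeasurable_rrState R Γ k).snd).mul_const _))).aestronglyMeasurable
  have hint' (k : ℕ) : Integrable (fun ω => x ^ (rrState R Γ (fun i => g i ω) k).1 *
      Real.exp ((rrState R Γ (fun i => g i ω) k).2 * (1 - lam⁻¹))) μ := by
    -- The Bochner integral of a non-integrable function is `0`, whereas this one is `lam ^ k`.
    refine Integrable.of_integral_ne_zero ?_
    rw [hE]
    positivity
  have hlow (k : ℕ) : lam ^ k ≤ ∫ ω, x ^ (rrState R Γ (fun i => g i ω) k).1 ∂μ := by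
    rw [← hE k]
    refine integral_mono_ae (hint' k) (hint k) ?_
    filter_upwards [hg.ae_nonneg] with ω hω
    refine mul_le_of_le_one_right (by positivity) (Real.exp_le_one_iff.2 ?_)
    exact mul_nonpos_of_nonneg_of_nonpos (rrState_mem_Ico hΓ hT hT0 hω k).1 hinv
  have hupp (k : ℕ) : (∫ ω, x ^ (rrState R Γ (fun i => g i ω) k).1 ∂μ) * c ≤ lam ^ k := by
    rw [← hE k, ← integral_mul_const]
    refine integral_mono_ae ((hint k).mul_const _) (hint' k) ?_
    filter_upwards [hg.ae_nonneg] with ω hω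
    refine mul_le_mul_of_nonneg_left (Real.exp_le_exp.2 ?_) (by positivity)
    exact mul_le_mul_of_nonpos_right (rrState_mem_Ico hΓ hT hT0 hω k).2.le hinv
  refine ⟨fun k => by simpa only [hpow] using hint k, ?_⟩
  simp only [hpow]
  -- The constant `c` costs only a term of order `1 / k`.
  have hlim : Tendsto (fun k : ℕ => -Real.log lam / θ + (Real.log c / θ) * (1 / (k : ℝ))) atTop
      (𝓝 (-Real.log lam / θ)) := by
    simpa using tendsto_const_nhds.add
      (tendsto_one_div_atTop_nhds_zero_nat.const_mul (Real.log c / θ))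
  refine tendsto_of_tendsto_of_tendsto_of_le_of_le' hlim tendsto_const_nhds ?_ ?_
  · filter_upwards [eventually_gt_atTop 0] with k hk
    have hk' : (0 : ℝ) < k := by exact_mod_cast hk
    have hI : 0 < ∫ ω, x ^ (rrState R Γ (fun i => g i ω) k).1 ∂μ :=
      (pow_pos hl0 k).trans_le (hlow k)
    have := Real.log_le_log (mul_pos hI hc0) (hupp k)
    rw [Real.log_mul hI.ne' hc0.ne', Real.log_pow] at this
    have e : -Real.log lam / θ + (Real.log c / θ) * (1 / (k : ℝ)) =
        -(1 / (θ * k)) * (k * Real.log lam - Real.log c) := by field_simp; ring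
    rw [e]
    exact mul_le_mul_of_nonpos_left (by linarith) (neg_nonpos.2 (by positivity))
  · filter_upwards [eventually_gt_atTop 0] with k hk
    have hk' : (0 : ℝ) < k := by exact_mod_cast hk
    have := Real.log_le_log (pow_pos hl0 k) (hlow k)
    rw [Real.log_pow] at this
    have e : -Real.log lam / θ = -(1 / (θ * k)) * (k * Real.log lam) := by field_simp
    rw [e]
    exact mul_le_mul_of_nonpos_left this (neg_nonpos.2 (by positivity))

end

theorem corollary12 {Ω : Type*} [MeasurableSpace Ω] (μ : Measure Ω) [IsProbabilityMeasure μ]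
    (g : ℕ → Ω → ℝ) (hg : IsBlockRayleighFading μ g)
    (R Γ θ T : ℝ) (hR : 0 < R) (hΓ : 0 < Γ) (hθ : 0 < θ)
    (hT : T = ((2 : ℝ) ^ R - 1) / Γ) :
    HasEffectiveCapacity μ θ (fun k ω => R * (rrPackets R Γ (fun i => g i ω) k : ℝ))
      (R - (1 / θ) * (lambertW0 (T * Real.exp (T + θ * R)) - T)) ∧
    IsPersistentSpectralRadius (rrSuccessProb μ g R Γ) (rrFailProb μ g R Γ) θ R
      (T / lambertW0 (T * Real.exp (T + θ * R))) ∧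
    R - (1 / θ) * (lambertW0 (T * Real.exp (T + θ * R)) - T) =
      -Real.log (T / lambertW0 (T * Real.exp (T + θ * R))) / θ := by
  have hT0 : 0 < T := by
    rw [hT]
    exact div_pos (sub_pos.2 (Real.one_lt_rpow one_lt_two hR)) hΓ
  have hθR : 0 < θ * R := mul_pos hθ hR
  obtain ⟨hl0, hl1, hl⟩ := lambert_radius_spec hT0 hθR
  rw [← neg_mul] at hl
  have hC : R - (1 / θ) * (lambertW0 (T * Real.exp (T + θ * R)) - T) =
      -Real.log (T / lambertW0 (T * Real.exp (T + θ * R))) / θ := by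
    rw [log_lambert_radius hT0 hθR]
    field_simp
    ring
  refine ⟨?_, ?_, hC⟩
  · rw [hC]
    exact hg.hasEffectiveCapacity hR hθ hΓ hT hT0 hl0 hl1 hl
  · exact isPersistentSpectralRadius_of_poisson hT0 (rrSuccessProb_succ hg hR hΓ hT)
      (fun _ => measureReal_nonneg) (rrFailProb_eq_one_sub hR) hl0 hl1 hl
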